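/- Let $k\ge 1$ and $n\ge 1$ be integers, let $0\le\lambda<\frac{1}{4k}$, $M>0$, $\alpha\in(0,1]$, $\sigma\ge 0$, and let $f:[0,1]\to\mathbb R$ satisfy $|f(x)-f(y)|\le M|x-y|^{\alpha}$ for all $x,y\in[0,1]$. Put $x_i=\frac{i-1}{n-1}$ for $i=1,\dots,n$ (and $x_1=0$ if $n=1$), and observe $y_i=(f(x_i)+\eta_i)\bmod 1$, where $\eta_1,\dots,\eta_n$ are i.i.d. $\mathcal N(0,\sigma^2)$. Let $h_i=e^{2\pi\iota f(x_i)}$ and $z_i=e^{2\pi\iota y_i}$, and for $v\in\mathbb C^n$ write $\bar v=(\mathrm{Re}(v)^T,\mathrm{Im}(v)^T)^T\in\mathbb R^{2n}$. Let $L$ be the Laplacian of the graph on $\{1,\dots,n\}$ with edges $\{i,j\}$, $i\ne j$, $|i-j|\le k$, and let $H=\begin{pmatrix}\lambda L&0\\0&\lambda L\end{pmatrix}$. Consider the trust-region problem $$\min_{\bar g\in\mathbb R^{2n}:\ \|\bar g\|_2^2=n}\ \bar g^TH\bar g-2\bar g^T\bar z.\qquad(\ast)$$ Then $(\ast)$ has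 a unique solution $\hat g\in\mathbb R^{2n}$, for every realization of the noise. Moreover, there are absolute constants $c,c'>0$ (not depending on any of the above) such that, if $n\ge 2$, then for every $\varepsilon\in(0,1/2)$ with $(1-\varepsilon)e^{-2\pi^2\sigma^2}\ge 1/2$ the following holds. 1. With probability at least $$1-2e\exp\Big(-\tfrac{c'(1-\varepsilon)^2(1-e^{-4\pi^2\sigma^2})^4e^{4\pi^2\sigma^2}}{2304}\,n\Big)-4\exp\Big(-\tfrac{c\,\varepsilon^2(1-e^{-4\pi^2\sigma^2})^4n}{1024}\Big)-e\exp\Big(-\tfrac{c'e^{-4\pi^2\sigma^2}n\varepsilon^2}{4}\Big)$$ one has $$\frac1n\langle\bar h,\hat g\rangle\ge 1-\Big(3\sqrt{\tfrac{1-(1-\varepsilon)e^{-2\pi^2\sigma^2}}{2}}-\frac{\lambda k}{6(4\lambda k+1)^2}(1-\varepsilon)(1-e^{-4\pi^2\sigma^2})^2\Big)-\frac{\lambda\pi^2M^2(2k)^{2\alpha+1}}{n^{2\alpha}}\Big(1-\frac{e^{-4\pi^2\sigma^2}}{(4\lambda k+1)^2}\Big).$$ 2. With probability at least $1-e\exp\big(-\tfrac{c'e^{-4\pi^2\sigma^2}n\varepsilon^2}{4}\big)$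 one has $$\frac1n\langle\bar h,\hat g\rangle\ge 1-3\sqrt{\tfrac{1-(1-\varepsilon)e^{-2\pi^2\sigma^2}}{2}}-\frac{\lambda\pi^2M^2(2k)^{2\alpha+1}}{n^{2\alpha}}.$$ -/

import Mathlib

open MeasureTheory ProbabilityTheory Matrix
open scoped BigOperators

namespace ModOne

noncomputable section

/-- The uniform grid on `[0,1]`. The indices `i : Fin n` are counted from `0`, so the `i`-th point
is `i / (n - 1)`. -/
def grid (n : ℕ) (i : Fin n) : ℝ := (i : ℝ) / ((n : ℝ) - 1)

/-- `f : [0,1] → ℝ` is Hölder continuous with exponent `α` and constant `M`. -/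
def IsHolderOnUnit (f : ℝ → ℝ) (M α : ℝ) : Prop :=
  ∀ x ∈ Set.Icc (0 : ℝ) 1, ∀ y ∈ Set.Icc (0 : ℝ) 1, |f x - f y| ≤ M * |x - y| ^ α

/-- The point `exp(2πι t)` of the unit circle. -/
def angular (t : ℝ) : ℂ := Complex.exp (2 * Real.pi * Complex.I * t)

/-- Clean signal in the angular domain, `h_i = exp(2πι f(x_i))`. -/
def cleanSignal (n : ℕ) (f : ℝ → ℝ) (i : Fin n) : ℂ := angular (f (grid n i))

/-- Noisy mod 1 samples, `y_i = (f(x_i) + η_i) mod 1`. -/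
def noisySample (n : ℕ) (f : ℝ → ℝ) (η : Fin n → ℝ) (i : Fin n) : ℝ :=
  Int.fract (f (grid n i) + η i)

/-- Noisy signal in the angular domain, `z_i = exp(2πι y_i)`. -/
def noisySignal (n : ℕ) (f : ℝ → ℝ) (η : Fin n → ℝ) (i : Fin n) : ℂ :=
  angular (noisySample n f η i)

/-- Real version `(Re v, Im v) ∈ ℝ^{2n}` of a vector `v ∈ ℂ^n`. -/
def realVersion {n : ℕ} (v : Fin n → ℂ) : Fin n ⊕ Fin n → ℝ :=
  Sum.elim (fun i => (v i).re) (fun i => (v i).im)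

/-- The graph on the `n` grid points with edges `{i, j}` for `i ≠ j` and `|i - j| ≤ k`. -/
def proximityGraph (n k : ℕ) : SimpleGraph (Fin n) where
  Adj i j := i ≠ j ∧ |(i : ℤ) - (j : ℤ)| ≤ (k : ℤ)
  symm := ⟨fun i j h => ⟨h.1.symm, by rw [abs_sub_comm]; exact h.2⟩⟩
  loopless := ⟨fun _ h => h.1 rfl⟩

instance (n k : ℕ) : DecidableRel (proximityGraph n k).Adj := fun i j =>
  inferInstanceAs (Decidable (i ≠ j ∧ |(i : ℤ) - (j : ℤ)| ≤ (k : ℤ)))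

/-- The block diagonal matrix `H = diag(lam * L, lam * L)`, `L` the graph Laplacian. -/
def blockLaplacian (n k : ℕ) (lam : ℝ) : Matrix (Fin n ⊕ Fin n) (Fin n ⊕ Fin n) ℝ :=
  Matrix.fromBlocks (lam • (proximityGraph n k).lapMatrix ℝ) 0
    0 (lam • (proximityGraph n k).lapMatrix ℝ)

/-- The objective `gᵀ H g - 2 gᵀ z`. -/
def objective (n k : ℕ) (lam : ℝ) (z g : Fin n ⊕ Fin n → ℝ) : ℝ :=
  g ⬝ᵥ (blockLaplacian n k lam *ᵥ g) - 2 * (g ⬝ᵥ z)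

/-- The sphere `‖g‖₂² = n` in `ℝ^{2n}`. -/
def feasibleSphere (n : ℕ) : Set (Fin n ⊕ Fin n → ℝ) := {g | ∑ i, g i ^ 2 = (n : ℝ)}

/-- `g` is a global minimizer of the trust-region problem
`min { gᵀ H g - 2 gᵀ z : g ∈ ℝ^{2n}, ‖g‖₂² = n }`. -/
def IsTrustRegionSolution (n k : ℕ) (lam : ℝ) (z g : Fin n ⊕ Fin n → ℝ) : Prop :=
  g ∈ feasibleSphere n ∧ IsMinOn (objective n k lam z) (feasibleSphere n) g

end

end ModOne

/-! ### Positive semidefinite forms and the stationarity equation on a sphere. -/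

section QuadraticForm

variable {ι : Type*} [Fintype ι] {A : Matrix ι ι ℝ} {t : ℝ}

/-! Since `4 * lam * k < 1`, the form of `H` lies between `0` and `t = 4 * lam * k < 1` on unit
vectors, so `(H + m) x = z` is solvable with `m > 0` and `‖x‖ = ‖z‖`. Completing the square in the
Lagrangian makes this `x` the unique minimizer.

Everything random enters through `⟨h, z⟩ = ∑ cos (2π η_i)`, which Hoeffding's inequality bounds
below by `n (1 - 2 s²)`; here `1 - 2 s² = (1 - ε) exp (-2π²σ²)`. The rest is deterministic
(`correlation_solution_ge`). As `‖z - h‖ ≤ 2 s √n`, `⟨h, x⟩` is at least `⟨x, z⟩ - 2 s n`.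
Optimality of `x` against `h` gives `2⟨x, z⟩ ≥ 2⟨h, z⟩ + xᵀHx - hᵀHh`, and `xᵀHx` is at least `hᵀHh
/ (1 + t)²` up to `s n`, while Hölder continuity bounds `hᵀHh`.

The loss in `s` obtained is `143/48 * s = (3 - 1/48) s`. The spare `s/48` pays for the gain term of
the first bound (`gain_le`), so both bounds hold on the single Hoeffding event. -/

theorem Matrix.PosSemidef.dotProduct_mulVec_comm_real (hA : A.PosSemidef) (x y : ι → ℝ) :
    x ⬝ᵥ (A *ᵥ y) = y ⬝ᵥ (A *ᵥ x) := by
  have h : Aᵀ = A := by simpa using hA.isHermitian.eq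
  rw [dotProduct_mulVec, ← mulVec_transpose, h, dotProduct_comm]

theorem Matrix.PosSemidef.nonneg_real (hA : A.PosSemidef) (x : ι → ℝ) :
    0 ≤ x ⬝ᵥ (A *ᵥ x) := by
  simpa using hA.dotProduct_mulVec_nonneg x

/-- Cauchy-Schwarz for the form of a positive semidefinite matrix. -/
theorem Matrix.PosSemidef.sq_dotProduct_mulVec_le (hA : A.PosSemidef) (x y : ι → ℝ) :
    (x ⬝ᵥ (A *ᵥ y)) ^ 2 ≤ (x ⬝ᵥ (A *ᵥ x)) * (y ⬝ᵥ (A *ᵥ y)) := by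
  have key : ∀ r : ℝ, 0 ≤ (y ⬝ᵥ (A *ᵥ y)) * (r * r) + (2 * (x ⬝ᵥ (A *ᵥ y))) * r
      + x ⬝ᵥ (A *ᵥ x) := by
    intro r
    have h := hA.nonneg_real (x + r • y)
    simp only [mulVec_add, mulVec_smul, dotProduct_add, add_dotProduct, dotProduct_smul,
      smul_dotProduct, smul_eq_mul] at h
    rw [hA.dotProduct_mulVec_comm_real y x] at h
    linarith
  have := discrim_le_zero key
  unfold discrim at this
  linarith

theorem dotProduct_self_nonneg_real (x : ι → ℝ) : 0 ≤ x ⬝ᵥ x :=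
  Finset.sum_nonneg fun i _ => mul_self_nonneg (x i)

theorem sq_dotProduct_le_real (x y : ι → ℝ) : (x ⬝ᵥ y) ^ 2 ≤ (x ⬝ᵥ x) * (y ⬝ᵥ y) := by
  classical
  simpa using (Matrix.PosSemidef.one (n := ι) (R := ℝ)).sq_dotProduct_mulVec_le x y

/-- A positive semidefinite matrix with form at most `t` satisfies `A² ≤ t A`. -/
theorem Matrix.PosSemidef.mulVec_dotProduct_self_le (hA : A.PosSemidef) (ht : 0 ≤ t)
    (hAt : ∀ x : ι → ℝ, x ⬝ᵥ (A *ᵥ x) ≤ t * (x ⬝ᵥ x)) (x : ι → ℝ) :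
    (A *ᵥ x) ⬝ᵥ (A *ᵥ x) ≤ t * (x ⬝ᵥ (A *ᵥ x)) := by
  -- Cauchy-Schwarz for the pair `A x`, `x` yields `‖Ax‖⁴ ≤ t ‖Ax‖² · xᵀAx`; then divide by `‖Ax‖²`.
  have h := hA.sq_dotProduct_mulVec_le (A *ᵥ x) x
  have h2 := hAt (A *ᵥ x)
  have h3 := hA.nonneg_real x
  have h4 := dotProduct_self_nonneg_real (A *ᵥ x)
  rcases h4.eq_or_lt with h0 | h0
  · rw [← h0]; positivity
  · refine le_of_mul_le_mul_left ?_ h0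
    nlinarith [mul_le_mul_of_nonneg_right h2 h3]

/-- Expansion of the norm of `(A + m) x`. -/
theorem dotProduct_self_shift (x : ι → ℝ) (m : ℝ) :
    (A *ᵥ x + m • x) ⬝ᵥ (A *ᵥ x + m • x)
      = (A *ᵥ x) ⬝ᵥ (A *ᵥ x) + 2 * m * (x ⬝ᵥ (A *ᵥ x)) + m ^ 2 * (x ⬝ᵥ x) := by
  simp only [dotProduct_add, add_dotProduct, dotProduct_smul, smul_dotProduct, smul_eq_mul]
  rw [dotProduct_comm (A *ᵥ x) x]
  ring

/-- Completion of the square for the Lagrangian at a stationary point. -/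
theorem Matrix.PosSemidef.lagrangian_eq (hA : A.PosSemidef) {x z : ι → ℝ} {m : ℝ}
    (hx : A *ᵥ x + m • x = z) (g : ι → ℝ) :
    (g ⬝ᵥ (A *ᵥ g) - 2 * (g ⬝ᵥ z)) + m * (g ⬝ᵥ g)
      = (x ⬝ᵥ (A *ᵥ x) - 2 * (x ⬝ᵥ z)) + m * (x ⬝ᵥ x)
        + ((g - x) ⬝ᵥ (A *ᵥ (g - x)) + m * ((g - x) ⬝ᵥ (g - x))) := by
  subst hx
  simp only [mulVec_sub, dotProduct_add, dotProduct_sub, sub_dotProduct,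
    dotProduct_smul, smul_eq_mul]
  rw [hA.dotProduct_mulVec_comm_real x g, dotProduct_comm x g]
  ring

/-- On the sphere through `z`, the stationarity equation has a solution with a multiplier in
`[1 - t, 1]`. -/
theorem Matrix.PosSemidef.exists_multiplier [DecidableEq ι] (hA : A.PosSemidef) (ht : 0 ≤ t)
    (ht1 : t < 1) (hAt : ∀ x : ι → ℝ, x ⬝ᵥ (A *ᵥ x) ≤ t * (x ⬝ᵥ x)) (z : ι → ℝ) :
    ∃ m : ℝ, 0 < m ∧ ∃ x : ι → ℝ, A *ᵥ x + m • x = z ∧ x ⬝ᵥ x = z ⬝ᵥ z := by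
  let B : ℝ → Matrix ι ι ℝ := fun m => A + m • (1 : Matrix ι ι ℝ)
  let X : ℝ → ι → ℝ := fun m => (B m)⁻¹ *ᵥ z
  have hB : ∀ m : ℝ, 0 < m → (B m).PosDef := fun m hm =>
    Matrix.PosDef.posSemidef_add hA (Matrix.PosDef.one.smul hm)
  have hX : ∀ m : ℝ, 0 < m → A *ᵥ X m + m • X m = z := by
    intro m hm
    have hu : IsUnit (B m).det := (Matrix.isUnit_iff_isUnit_det _).1 (hB m hm).isUnit
    have : B m *ᵥ X m = z := by
      simp only [X, mulVec_mulVec, Matrix.mul_nonsing_inv _ hu, one_mulVec]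
    simpa [B, add_mulVec, smul_mulVec] using this
  have hcB : Continuous B := by fun_prop
  -- Intermediate value theorem for `‖X m‖²`: `A + 1 ≥ 1` makes it at most `‖z‖²` at `m = 1`, and `A
  -- + (1 - t) ≤ 1` makes it at least `‖z‖²` at `m = 1 - t`, which is positive because `t < 1`.
  have hcont : ContinuousOn (fun m => X m ⬝ᵥ X m) (Set.Icc (1 - t) 1) := by
    have h1 : ContinuousOn (fun m => X m) (Set.Icc (1 - t) 1) := by
      have h2 : ContinuousOn (fun m => ((B m).det)⁻¹ • ((B m).adjugate *ᵥ z))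
          (Set.Icc (1 - t) 1) := by
        refine ContinuousOn.smul (ContinuousOn.inv₀ hcB.matrix_det.continuousOn ?_) ?_
        · intro m hm
          exact (hB m (by linarith [hm.1])).det_pos.ne'
        · exact (hcB.matrix_adjugate.matrix_mulVec continuous_const).continuousOn
      refine h2.congr fun m _ => ?_
      simp only [X, Matrix.inv_def, smul_mulVec, Ring.inverse_eq_inv']
    have h3 : Continuous fun v : ι → ℝ => v ⬝ᵥ v := continuous_id.dotProduct continuous_id
    exact h3.comp_continuousOn h1
  have hlow : X 1 ⬝ᵥ X 1 ≤ z ⬝ᵥ z := by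
    have h := dotProduct_self_shift (A := A) (X 1) 1
    rw [hX 1 one_pos] at h
    have := hA.nonneg_real (X 1)
    have := dotProduct_self_nonneg_real (A *ᵥ X 1)
    linarith
  have hhigh : z ⬝ᵥ z ≤ X (1 - t) ⬝ᵥ X (1 - t) := by
    have h := dotProduct_self_shift (A := A) (X (1 - t)) (1 - t)
    rw [hX (1 - t) (by linarith)] at h
    have h1 := hA.mulVec_dotProduct_self_le ht hAt (X (1 - t))
    have h2 := mul_le_mul_of_nonneg_left (hAt (X (1 - t))) (by linarith : 0 ≤ 2 - t)
    nlinarith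
  obtain ⟨m, hm, hmz⟩ := intermediate_value_Icc' (by linarith : 1 - t ≤ 1) hcont
    (Set.mem_Icc.2 ⟨hlow, hhigh⟩)
  have hm0 : 0 < m := by linarith [hm.1]
  exact ⟨m, hm0, X m, hX m hm0, hmz⟩

/-- The solution of the stationarity equation makes a small angle with the data. -/
theorem Matrix.PosSemidef.four_fifths_le_dotProduct (hA : A.PosSemidef) (ht : 0 ≤ t)
    (ht1 : t ≤ 1) (hAt : ∀ x : ι → ℝ, x ⬝ᵥ (A *ᵥ x) ≤ t * (x ⬝ᵥ x)) {x z : ι → ℝ} {m N : ℝ}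
    (hm : 0 < m) (hx : A *ᵥ x + m • x = z) (hxN : x ⬝ᵥ x = N) (hzN : z ⬝ᵥ z = N) :
    4 / 5 * N ≤ x ⬝ᵥ z := by
  have hN : 0 ≤ N := hxN ▸ dotProduct_self_nonneg_real x
  have h := dotProduct_self_shift (A := A) x m
  rw [hx, hzN, hxN] at h
  have h1 := hA.mulVec_dotProduct_self_le ht hAt x
  have hxz : x ⬝ᵥ z = x ⬝ᵥ (A *ᵥ x) + m * N := by
    rw [← hx, dotProduct_add, dotProduct_smul, hxN, smul_eq_mul]
  have hy := hA.nonneg_real x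
  -- From `‖z‖² = ‖x‖²` and `‖Ax‖² ≤ xᵀAx`. It gives `(1 + 2m)⟨x, z⟩ ≥ N (1 + m + m²)`, and `1 + m +
  -- m² - 4/5 (1 + 2m)` exceeds `(m - 3/10)²`.
  have h2 : N * (1 - m ^ 2) ≤ (1 + 2 * m) * (x ⬝ᵥ (A *ᵥ x)) := by nlinarith
  rw [hxz]
  refine le_of_mul_le_mul_left ?_ (by linarith : 0 < 1 + 2 * m)
  nlinarith [mul_nonneg hN (sq_nonneg (m - 3 / 10))]

/-- The multiplier is at most one, hence smoothing does not decrease the form much. -/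
theorem Matrix.PosSemidef.form_le_form_solution (hA : A.PosSemidef) (ht : 0 ≤ t)
    (hAt : ∀ x : ι → ℝ, x ⬝ᵥ (A *ᵥ x) ≤ t * (x ⬝ᵥ x)) {x z : ι → ℝ} {m N : ℝ}
    (hm : 0 < m) (hx : A *ᵥ x + m • x = z) (hN : 0 < N) (hxN : x ⬝ᵥ x = N) (hzN : z ⬝ᵥ z = N) :
    z ⬝ᵥ (A *ᵥ z) ≤ (1 + t) ^ 2 * (x ⬝ᵥ (A *ᵥ x)) := by
  have h := dotProduct_self_shift (A := A) x m
  rw [hx, hzN, hxN] at h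
  have hy := hA.nonneg_real x
  have hw := dotProduct_self_nonneg_real (A *ᵥ x)
  have hm1 : m ≤ 1 := by
    by_contra hc
    push Not at hc
    have : 0 ≤ 2 * m * (x ⬝ᵥ (A *ᵥ x)) := by positivity
    have : N * 1 < N * m ^ 2 := mul_lt_mul_of_pos_left (by nlinarith) hN
    linarith
  have h1 := hA.mulVec_dotProduct_self_le ht hAt x
  have h2 := hAt (A *ᵥ x)
  -- With `m ≤ 1`, the three terms are at most `t²`, `2t` and `1` times `xᵀAx`.
  have hz : z ⬝ᵥ (A *ᵥ z) = (A *ᵥ x) ⬝ᵥ (A *ᵥ (A *ᵥ x)) + 2 * m * ((A *ᵥ x) ⬝ᵥ (A *ᵥ x))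
      + m ^ 2 * (x ⬝ᵥ (A *ᵥ x)) := by
    rw [← hx]
    simp only [mulVec_add, mulVec_smul, dotProduct_add, add_dotProduct, dotProduct_smul,
      smul_dotProduct, smul_eq_mul]
    rw [hA.dotProduct_mulVec_comm_real x (A *ᵥ x)]
    ring
  have h3 : t * ((A *ᵥ x) ⬝ᵥ (A *ᵥ x)) ≤ t * (t * (x ⬝ᵥ (A *ᵥ x))) :=
    mul_le_mul_of_nonneg_left h1 ht
  have h4 : m * ((A *ᵥ x) ⬝ᵥ (A *ᵥ x)) ≤ t * (x ⬝ᵥ (A *ᵥ x)) :=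
    (mul_le_of_le_one_left hw hm1).trans h1
  have h5 : m ^ 2 * (x ⬝ᵥ (A *ᵥ x)) ≤ x ⬝ᵥ (A *ᵥ x) :=
    mul_le_of_le_one_left hy (by nlinarith)
  nlinarith

/-- Deterministic recovery bound for the trust-region solution, when the data `z` correlates
with the signal `h`. -/
theorem Matrix.PosSemidef.correlation_solution_ge (hA : A.PosSemidef) (ht : 0 ≤ t)
    (ht1 : t ≤ 1) (hAt : ∀ x : ι → ℝ, x ⬝ᵥ (A *ᵥ x) ≤ t * (x ⬝ᵥ x)) {h x z : ι → ℝ}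
    {m N s : ℝ} (hm : 0 < m) (hx : A *ᵥ x + m • x = z) (hN : 0 < N) (hxN : x ⬝ᵥ x = N)
    (hzN : z ⬝ᵥ z = N) (hhN : h ⬝ᵥ h = N) (hs : 0 ≤ s)
    (hhz : N * (1 - 2 * s ^ 2) ≤ h ⬝ᵥ z) :
    N * (1 - 143 / 48 * s) - h ⬝ᵥ (A *ᵥ h) / 2 * (1 - 1 / (1 + t) ^ 2) ≤ h ⬝ᵥ x := by
  have hdN : (z - h) ⬝ᵥ (z - h) ≤ N * (2 * s) ^ 2 := by
    simp only [dotProduct_sub, sub_dotProduct]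
    rw [dotProduct_comm z h, hzN, hhN]
    nlinarith
  have hhx : x ⬝ᵥ z - 2 * s * N ≤ h ⬝ᵥ x := by
    have h1 := sq_dotProduct_le_real (z - h) x
    have h2 : ((z - h) ⬝ᵥ x) ^ 2 ≤ (2 * s * N) ^ 2 := by
      rw [hxN] at h1
      nlinarith
    have h3 := (abs_le_of_sq_le_sq' h2 (by positivity)).2
    rw [sub_dotProduct, dotProduct_comm z x] at h3
    linarith
  have hb := hA.nonneg_real h
  have hT : 1 ≤ (1 + t) ^ 2 := by nlinarith
  have hT0 : 0 < (1 + t) ^ 2 := by positivity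
  -- For small `s` the loss is `2 s + s/2 + 2 s² ≤ 2.96 s`, below `143/48 * s`. For larger `s` the
  -- crude `⟨x, z⟩ ≥ 4/5 N` is enough, as `47/48 * s > 1/5`.
  by_cases hs1 : s ≤ 23 / 100
  · have hopt := hA.lagrangian_eq hx h
    have hpos1 := hA.nonneg_real (h - x)
    have hpos2 := mul_nonneg hm.le (dotProduct_self_nonneg_real (h - x))
    rw [hhN, hxN] at hopt
    have hG := hA.form_le_form_solution ht hAt hm hx hN hxN hzN
    have hcross : -(t * (2 * s) * N) ≤ h ⬝ᵥ (A *ᵥ (z - h)) := by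
      have h1 := hA.sq_dotProduct_mulVec_le h (z - h)
      have h2 := hAt h
      have h3 := (hAt (z - h)).trans (mul_le_mul_of_nonneg_left hdN ht)
      rw [hhN] at h2
      have h4 : (h ⬝ᵥ (A *ᵥ (z - h))) ^ 2 ≤ (t * (2 * s) * N) ^ 2 := by
        refine h1.trans ((mul_le_mul h2 h3 (hA.nonneg_real _) (by positivity)).trans_eq ?_)
        ring
      exact (abs_le_of_sq_le_sq' h4 (by positivity)).1
    have hzz : h ⬝ᵥ (A *ᵥ h) - 4 * t * s * N ≤ z ⬝ᵥ (A *ᵥ z) := by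
      have h1 := hA.nonneg_real (z - h)
      have h2 : z ⬝ᵥ (A *ᵥ z) = h ⬝ᵥ (A *ᵥ h) + 2 * (h ⬝ᵥ (A *ᵥ (z - h)))
          + (z - h) ⬝ᵥ (A *ᵥ (z - h)) := by
        simp only [mulVec_sub, dotProduct_sub, sub_dotProduct]
        rw [hA.dotProduct_mulVec_comm_real z h]
        ring
      linarith
    -- The error `4 t s N / (1 + t)²` is at most `s N`, because `(1 - t)² ≥ 0`.
    have hxx : h ⬝ᵥ (A *ᵥ h) / (1 + t) ^ 2 - s * N ≤ x ⬝ᵥ (A *ᵥ x) := by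
      rw [div_sub' hT0.ne', div_le_iff₀ hT0]
      have : 0 ≤ s * N * (1 - t) ^ 2 := by positivity
      nlinarith
    have he : h ⬝ᵥ (A *ᵥ h) / 2 * (1 - 1 / (1 + t) ^ 2)
        = h ⬝ᵥ (A *ᵥ h) / 2 - h ⬝ᵥ (A *ᵥ h) / (1 + t) ^ 2 / 2 := by ring
    rw [he]
    have : N * (2 * s ^ 2) ≤ N * (46 / 100 * s) := by
      apply mul_le_mul_of_nonneg_left _ hN.le
      nlinarith
    have : 0 ≤ N * s := by positivity
    nlinarith
  · push Not at hs1
    have h1 := hA.four_fifths_le_dotProduct ht ht1 hAt hm hx hxN hzN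
    have h2 : 0 ≤ h ⬝ᵥ (A *ᵥ h) / 2 * (1 - 1 / (1 + t) ^ 2) := by
      refine mul_nonneg (by positivity) (sub_nonneg.2 ?_)
      rw [div_le_one hT0]; exact hT
    nlinarith

end QuadraticForm

namespace ModOne

/-! ### Spectral bounds for the graph Laplacian. -/

section Graph

variable {n k : ℕ}

theorem degree_proximityGraph_le (n k : ℕ) (i : Fin n) :
    (proximityGraph n k).degree i ≤ 2 * k := by
  have hsub : ((proximityGraph n k).neighborFinset i).image (fun j : Fin n => ((j : ℕ) : ℤ))
      ⊆ (Finset.Icc ((i : ℤ) - k) ((i : ℤ) + k)).erase (i : ℤ) := by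
    intro a ha
    obtain ⟨j, hj, rfl⟩ := Finset.mem_image.1 ha
    rw [SimpleGraph.mem_neighborFinset] at hj
    obtain ⟨hne, habs⟩ := hj
    have hne' : ((j : ℕ) : ℤ) ≠ (i : ℕ) := fun h => hne (Fin.ext (by exact_mod_cast h.symm))
    rw [abs_le] at habs
    exact Finset.mem_erase.2 ⟨hne', Finset.mem_Icc.2 ⟨by linarith [habs.2], by linarith [habs.1]⟩⟩
  have hinj : Function.Injective (fun j : Fin n => ((j : ℕ) : ℤ)) := fun a b h =>
    Fin.ext (Nat.cast_injective (R := ℤ) h)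
  have hcard := Finset.card_le_card hsub
  rw [Finset.card_image_of_injective _ hinj, SimpleGraph.card_neighborFinset_eq_degree,
    Finset.card_erase_of_mem (by simp), Int.card_Icc] at hcard
  omega

/-- The quadratic form of the Laplacian. -/
theorem dotProduct_lapMatrix (x : Fin n → ℝ) :
    x ⬝ᵥ ((proximityGraph n k).lapMatrix ℝ *ᵥ x)
      = (∑ i, ∑ j, if (proximityGraph n k).Adj i j then (x i - x j) ^ 2 else 0) / 2 := by
  rw [← SimpleGraph.lapMatrix_toLinearMap₂', toLinearMap₂'_apply']

theorem sum_adj_eq (i : Fin n) (c : ℝ) :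
    (∑ j, if (proximityGraph n k).Adj i j then c else 0)
      = (proximityGraph n k).degree i * c := by
  rw [SimpleGraph.degree_eq_sum_if_adj (R := ℝ) (proximityGraph n k) i, Finset.sum_mul]
  exact Finset.sum_congr rfl fun j _ => by split_ifs <;> simp

/-- Each edge costs `(a - b)² ≤ 2a² + 2b²`, so the form is at most twice the degree-weighted norm,
and degrees are at most `2k`. -/
theorem dotProduct_lapMatrix_le (x : Fin n → ℝ) :
    x ⬝ᵥ ((proximityGraph n k).lapMatrix ℝ *ᵥ x) ≤ 4 * k * (x ⬝ᵥ x) := by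
  rw [dotProduct_lapMatrix]
  have h1 : (∑ i, ∑ j, if (proximityGraph n k).Adj i j then (x i - x j) ^ 2 else 0)
      ≤ ∑ i, ∑ j, ((if (proximityGraph n k).Adj i j then 2 * x i ^ 2 else 0)
        + (if (proximityGraph n k).Adj j i then 2 * x j ^ 2 else 0)) := by
    refine Finset.sum_le_sum fun i _ => Finset.sum_le_sum fun j _ => ?_
    by_cases h : (proximityGraph n k).Adj i j
    · rw [if_pos h, if_pos h, if_pos h.symm]
      nlinarith [sq_nonneg (x i + x j)]
    · rw [if_neg h, if_neg h, if_neg fun h' => h h'.symm]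
      simp
  have h2 : (∑ i, ∑ j, ((if (proximityGraph n k).Adj i j then 2 * x i ^ 2 else 0)
        + (if (proximityGraph n k).Adj j i then 2 * x j ^ 2 else 0)))
      = 2 * ∑ i, (proximityGraph n k).degree i * (2 * x i ^ 2) := by
    simp_rw [Finset.sum_add_distrib]
    rw [Finset.sum_comm (f := fun i j : Fin n =>
      if (proximityGraph n k).Adj j i then 2 * x j ^ 2 else 0)]
    simp_rw [sum_adj_eq]
    ring
  have h3 : ∑ i, ((proximityGraph n k).degree i : ℝ) * (2 * x i ^ 2)
      ≤ ∑ i, 4 * k * (x i * x i) := by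
    refine Finset.sum_le_sum fun i _ => ?_
    have : ((proximityGraph n k).degree i : ℝ) ≤ 2 * k := by
      exact_mod_cast degree_proximityGraph_le n k i
    nlinarith [mul_le_mul_of_nonneg_right this (sq_nonneg (x i))]
  rw [← Finset.mul_sum] at h3
  change _ ≤ 4 * (k : ℝ) * ∑ i, x i * x i
  linarith

theorem dotProduct_blockLaplacian (lam : ℝ) (x : Fin n ⊕ Fin n → ℝ) :
    x ⬝ᵥ (blockLaplacian n k lam *ᵥ x)
      = lam * ((x ∘ Sum.inl) ⬝ᵥ ((proximityGraph n k).lapMatrix ℝ *ᵥ (x ∘ Sum.inl))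
        + (x ∘ Sum.inr) ⬝ᵥ ((proximityGraph n k).lapMatrix ℝ *ᵥ (x ∘ Sum.inr))) := by
  rw [blockLaplacian, fromBlocks_mulVec]
  simp only [zero_mulVec, add_zero, zero_add, dotProduct, Fintype.sum_sum_type, Sum.elim_inl,
    Sum.elim_inr, smul_mulVec, Pi.smul_apply, smul_eq_mul, Function.comp_apply, mul_add,
    Finset.mul_sum]
  congr 1 <;> exact Finset.sum_congr rfl fun i _ => by ring

theorem posSemidef_blockLaplacian {lam : ℝ} (hlam : 0 ≤ lam) :
    (blockLaplacian n k lam).PosSemidef := by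
  have hL := SimpleGraph.posSemidef_lapMatrix ℝ (proximityGraph n k)
  refine Matrix.PosSemidef.of_dotProduct_mulVec_nonneg ?_ fun x => ?_
  · have h := (hL.smul hlam).isHermitian
    exact Matrix.IsHermitian.fromBlocks h (by simp) h
  · rw [star_trivial, dotProduct_blockLaplacian]
    exact mul_nonneg hlam (add_nonneg (hL.nonneg_real _) (hL.nonneg_real _))

theorem dotProduct_blockLaplacian_le {lam : ℝ} (hlam : 0 ≤ lam) (x : Fin n ⊕ Fin n → ℝ) :
    x ⬝ᵥ (blockLaplacian n k lam *ᵥ x) ≤ 4 * lam * k * (x ⬝ᵥ x) := by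
  rw [dotProduct_blockLaplacian]
  have h1 := dotProduct_lapMatrix_le (k := k) (x ∘ Sum.inl)
  have h2 := dotProduct_lapMatrix_le (k := k) (x ∘ Sum.inr)
  have h3 : x ⬝ᵥ x = (x ∘ Sum.inl) ⬝ᵥ (x ∘ Sum.inl) + (x ∘ Sum.inr) ⬝ᵥ (x ∘ Sum.inr) := by
    simp [dotProduct, Fintype.sum_sum_type]
  rw [h3]
  nlinarith [mul_le_mul_of_nonneg_left (add_le_add h1 h2) hlam]

end Graph

/-! ### Clean and noisy signals on the unit circle. -/

section Signal

variable {n k : ℕ} {f : ℝ → ℝ} {M α : ℝ}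

theorem angular_eq (t : ℝ) :
    angular t = Complex.exp (((2 * Real.pi * t : ℝ) : ℂ) * Complex.I) := by
  unfold angular; congr 1; push_cast; ring

theorem angular_re (t : ℝ) : (angular t).re = Real.cos (2 * Real.pi * t) := by
  rw [angular_eq, Complex.exp_ofReal_mul_I_re]

theorem angular_im (t : ℝ) : (angular t).im = Real.sin (2 * Real.pi * t) := by
  rw [angular_eq, Complex.exp_ofReal_mul_I_im]

theorem angular_fract (t : ℝ) : angular (Int.fract t) = angular t := by
  have h : 2 * Real.pi * Int.fract t = 2 * Real.pi * t - ⌊t⌋ * (2 * Real.pi) := by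
    rw [Int.fract]; ring
  apply Complex.ext
  · rw [angular_re, angular_re, h, Real.cos_sub_int_mul_two_pi]
  · rw [angular_im, angular_im, h, Real.sin_sub_int_mul_two_pi]

theorem dotProduct_realVersion (v w : Fin n → ℂ) :
    realVersion v ⬝ᵥ realVersion w = ∑ i, ((v i).re * (w i).re + (v i).im * (w i).im) := by
  simp [realVersion, dotProduct, Fintype.sum_sum_type, Finset.sum_add_distrib]

theorem dotProduct_realVersion_angular (u v : Fin n → ℝ) :
    realVersion (fun i => angular (u i)) ⬝ᵥ realVersion (fun i => angular (v i))
      = ∑ i, Real.cos (2 * Real.pi * (v i - u i)) := by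
  rw [dotProduct_realVersion]
  refine Finset.sum_congr rfl fun i _ => ?_
  rw [angular_re, angular_re, angular_im, angular_im, mul_sub, Real.cos_sub]
  ring

theorem dotProduct_realVersion_angular_self (u : Fin n → ℝ) :
    realVersion (fun i => angular (u i)) ⬝ᵥ realVersion (fun i => angular (u i)) = n := by
  rw [dotProduct_realVersion_angular]
  simp

/-- Reduction mod 1 is invisible on the circle, and the phase of `f` cancels, so only the noise
remains. -/
theorem cleanSignal_dotProduct_noisySignal (η : Fin n → ℝ) :
    realVersion (cleanSignal n f) ⬝ᵥ realVersion (noisySignal n f η)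
      = ∑ i, Real.cos (2 * Real.pi * η i) := by
  have h : noisySignal n f η = fun i => angular (f (grid n i) + η i) := by
    funext i; exact angular_fract _
  rw [h]
  refine (dotProduct_realVersion_angular _ _).trans (Finset.sum_congr rfl fun i _ => ?_)
  congr 2; ring

theorem grid_mem_Icc (hn : 2 ≤ n) (i : Fin n) : grid n i ∈ Set.Icc (0 : ℝ) 1 := by
  have h2 : (2 : ℝ) ≤ n := by exact_mod_cast hn
  have hi : ((i : ℕ) : ℝ) + 1 ≤ n := by exact_mod_cast i.2
  exact ⟨div_nonneg (Nat.cast_nonneg _) (by linarith),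
    (div_le_one (by linarith)).2 (by linarith)⟩

/-- The factor 2 comes from `n ≤ 2 (n - 1)`, valid for `n ≥ 2`. -/
theorem abs_grid_sub_grid_le (hn : 2 ≤ n) {i j : Fin n} (h : (proximityGraph n k).Adj i j) :
    |grid n i - grid n j| ≤ 2 * k / n := by
  have h2 : (2 : ℝ) ≤ n := by exact_mod_cast hn
  have hij : |((i : ℕ) : ℝ) - ((j : ℕ) : ℝ)| ≤ k := by exact_mod_cast h.2
  unfold grid
  rw [← sub_div, abs_div, abs_of_pos (by linarith : (0 : ℝ) < n - 1),
    div_le_div_iff₀ (by linarith) (by linarith)]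
  have hk : (0 : ℝ) ≤ k := Nat.cast_nonneg k
  nlinarith

theorem sq_re_sub_add_sq_im_sub_angular_le (u v : ℝ) :
    ((angular u).re - (angular v).re) ^ 2 + ((angular u).im - (angular v).im) ^ 2
      ≤ (2 * Real.pi * |u - v|) ^ 2 := by
  have h1 : ((angular u).re - (angular v).re) ^ 2 + ((angular u).im - (angular v).im) ^ 2
      = 2 - 2 * Real.cos (2 * Real.pi * (u - v)) := by
    rw [angular_re, angular_re, angular_im, angular_im, mul_sub, Real.cos_sub]
    nlinarith [Real.sin_sq_add_cos_sq (2 * Real.pi * u), Real.sin_sq_add_cos_sq (2 * Real.pi * v)]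
  rw [h1, mul_pow, sq_abs, ← mul_pow]
  linarith [Real.one_sub_sq_div_two_le_cos (x := 2 * Real.pi * (u - v))]

/-- Smoothness of the clean signal along the edges of the graph. -/
theorem cleanSignal_blockLaplacian_le {lam : ℝ} (hlam : 0 ≤ lam) (hn : 2 ≤ n) (hM : 0 < M)
    (hα : 0 < α) (hf : IsHolderOnUnit f M α) :
    realVersion (cleanSignal n f) ⬝ᵥ (blockLaplacian n k lam *ᵥ realVersion (cleanSignal n f)) / 2
      ≤ n * (lam * Real.pi ^ 2 * M ^ 2 * (2 * (k : ℝ)) ^ (2 * α + 1) / (n : ℝ) ^ (2 * α)) := by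
  have hn0 : (0 : ℝ) < n := by exact_mod_cast (by omega : 0 < n)
  set D : ℝ := (2 * Real.pi * (M * (2 * k / n) ^ α)) ^ 2 with hD
  have hedge : ∀ i j : Fin n, (proximityGraph n k).Adj i j →
      ((cleanSignal n f i).re - (cleanSignal n f j).re) ^ 2
        + ((cleanSignal n f i).im - (cleanSignal n f j).im) ^ 2 ≤ D := by
    intro i j hij
    refine (sq_re_sub_add_sq_im_sub_angular_le _ _).trans ?_
    have h1 := hf _ (grid_mem_Icc hn i) _ (grid_mem_Icc hn j)
    have h2 : |grid n i - grid n j| ^ α ≤ (2 * k / n : ℝ) ^ α :=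
      Real.rpow_le_rpow (abs_nonneg _) (abs_grid_sub_grid_le hn hij) hα.le
    have h3 := h1.trans (mul_le_mul_of_nonneg_left h2 hM.le)
    have := Real.pi_pos
    rw [hD]
    gcongr
  have hsum : realVersion (cleanSignal n f) ⬝ᵥ
      (blockLaplacian n k lam *ᵥ realVersion (cleanSignal n f)) ≤ lam * (n * (2 * k * D) / 2) := by
    rw [dotProduct_blockLaplacian, dotProduct_lapMatrix, dotProduct_lapMatrix, ← add_div,
      ← Finset.sum_add_distrib]
    refine mul_le_mul_of_nonneg_left (div_le_div_of_nonneg_right ?_ zero_le_two) hlam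
    have : ∀ i : Fin n, ((∑ j, if (proximityGraph n k).Adj i j then
          ((realVersion (cleanSignal n f) ∘ Sum.inl) i
            - (realVersion (cleanSignal n f) ∘ Sum.inl) j) ^ 2 else 0)
        + ∑ j, if (proximityGraph n k).Adj i j then
          ((realVersion (cleanSignal n f) ∘ Sum.inr) i
            - (realVersion (cleanSignal n f) ∘ Sum.inr) j) ^ 2 else 0) ≤ 2 * k * D := by
      intro i
      rw [← Finset.sum_add_distrib]
      calc _ ≤ ∑ j, (if (proximityGraph n k).Adj i j then D else 0) := by
            refine Finset.sum_le_sum fun j _ => ?_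
            by_cases h : (proximityGraph n k).Adj i j
            · rw [if_pos h, if_pos h, if_pos h]
              exact hedge i j h
            · simp [if_neg h]
        _ = (proximityGraph n k).degree i * D := sum_adj_eq i D
        _ ≤ 2 * k * D := by
            refine mul_le_mul_of_nonneg_right ?_ (sq_nonneg _)
            exact_mod_cast degree_proximityGraph_le n k i
    refine (Finset.sum_le_sum fun i _ => this i).trans_eq ?_
    simp
  -- The extra factor `2k` is the degree bound; the power `2 * α` comes from the squared Hölder
  -- estimate on an edge.
  have hpow : (2 * (k : ℝ)) ^ (2 * α + 1) / (n : ℝ) ^ (2 * α)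
      = 2 * k * ((2 * k / n : ℝ) ^ α) ^ 2 := by
    rw [Real.rpow_add_one' (by positivity) (by positivity), ← Real.rpow_natCast,
      ← Real.rpow_mul (by positivity), Real.div_rpow (by positivity) hn0.le]
    push_cast
    rw [mul_comm α 2]
    ring
  rw [mul_div_assoc, hpow]
  refine (div_le_div_of_nonneg_right hsum zero_le_two).trans_eq ?_
  rw [hD]
  ring

end Signal

/-! ### Existence and uniqueness of the minimizer. -/

section TrustRegion

variable {n k : ℕ} {lam : ℝ}

theorem mem_feasibleSphere {g : Fin n ⊕ Fin n → ℝ} : g ∈ feasibleSphere n ↔ g ⬝ᵥ g = n := by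
  simp [feasibleSphere, dotProduct, sq]

/-- The trust-region problem has a unique solution, characterized by the stationarity equation
with a positive multiplier. -/
theorem exists_stationary_unique (hlam : 0 ≤ lam) (hk : 4 * lam * k < 1)
    {z : Fin n ⊕ Fin n → ℝ} (hz : z ⬝ᵥ z = n) :
    ∃ m : ℝ, 0 < m ∧ ∃ x : Fin n ⊕ Fin n → ℝ, blockLaplacian n k lam *ᵥ x + m • x = z ∧
      IsTrustRegionSolution n k lam z x ∧
      ∀ g, IsTrustRegionSolution n k lam z g → g = x := by
  have hA := posSemidef_blockLaplacian (n := n) (k := k) hlam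
  obtain ⟨m, hm, x, hx, hxz⟩ := hA.exists_multiplier (t := 4 * lam * k) (by positivity) hk
    (dotProduct_blockLaplacian_le hlam) z
  rw [hz] at hxz
  refine ⟨m, hm, x, hx, ⟨mem_feasibleSphere.2 hxz, isMinOn_iff.2 fun g hg => ?_⟩, ?_⟩
  · have h := hA.lagrangian_eq hx g
    rw [mem_feasibleSphere.1 hg, hxz] at h
    have h1 := hA.nonneg_real (g - x)
    have h2 := mul_nonneg hm.le (dotProduct_self_nonneg_real (g - x))
    unfold objective
    linarith
  · rintro g ⟨hg, hmin⟩
    have h := hA.lagrangian_eq hx g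
    rw [mem_feasibleSphere.1 hg, hxz] at h
    have h1 := hA.nonneg_real (g - x)
    have h2 := isMinOn_iff.1 hmin x (mem_feasibleSphere.2 hxz)
    unfold objective at h2
    have h3 : m * ((g - x) ⬝ᵥ (g - x)) ≤ 0 := by linarith
    have h4 : (g - x) ⬝ᵥ (g - x) = 0 :=
      le_antisymm (nonpos_of_mul_nonpos_right h3 hm) (dotProduct_self_nonneg_real _)
    exact sub_eq_zero.1 (dotProduct_self_eq_zero.1 h4)

end TrustRegion

/-! ### Concentration of `∑ cos (2π η_i)`. -/

section Concentration

/-- This is the real part of the Gaussian characteristic function. -/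
theorem integral_cos_gaussianReal (v : NNReal) (t : ℝ) :
    ∫ x, Real.cos (t * x) ∂(gaussianReal 0 v) = Real.exp (-v * t ^ 2 / 2) := by
  have h := congrArg Complex.re (charFun_gaussianReal (μ := 0) (v := v) t)
  rw [charFun_apply_real] at h
  have hint : Integrable (fun x : ℝ => Complex.exp (t * x * Complex.I)) (gaussianReal 0 v) := by
    refine (integrable_const (1 : ℝ)).mono' (by fun_prop) (Filter.Eventually.of_forall fun x => ?_)
    rw [← Complex.ofReal_mul, Complex.norm_exp_ofReal_mul_I]
  rw [← RCLike.re_eq_complex_re, ← integral_re hint] at h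
  have h1 : ∀ x : ℝ, RCLike.re (Complex.exp (t * x * Complex.I)) = Real.cos (t * x) := fun x => by
    rw [RCLike.re_eq_complex_re, ← Complex.ofReal_mul, Complex.exp_ofReal_mul_I_re]
  simp_rw [h1] at h
  rw [h, RCLike.re_eq_complex_re]
  have h2 : (t * (0 : ℝ) * Complex.I - (v : ℂ) * t ^ 2 / 2 : ℂ)
      = ((-v * t ^ 2 / 2 : ℝ) : ℂ) := by
    push_cast; ring
  rw [h2, Complex.exp_ofReal_re]

/-- Hoeffding bound for the cosines of Gaussian phases. -/
theorem measureReal_sum_cos_ge {Ω : Type*} [MeasurableSpace Ω] (μ : Measure Ω)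
    [IsProbabilityMeasure μ] {n : ℕ} (hn : 1 ≤ n) {σ : ℝ} {η : Fin n → Ω → ℝ}
    (hη : ∀ i, HasLaw (η i) (gaussianReal 0 (Real.toNNReal (σ ^ 2))) μ) (hind : iIndepFun η μ)
    {ε : ℝ} (hε : 0 < ε) :
    1 - Real.exp (-(Real.exp (-4 * Real.pi ^ 2 * σ ^ 2) * n * ε ^ 2 / 2))
      ≤ μ.real {ω | n * ((1 - ε) * Real.exp (-2 * Real.pi ^ 2 * σ ^ 2))
          ≤ ∑ i, Real.cos (2 * Real.pi * η i ω)} := by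
  set r := Real.exp (-2 * Real.pi ^ 2 * σ ^ 2) with hr
  have hr0 : 0 < r := Real.exp_pos _
  have hn0 : (0 : ℝ) < n := by exact_mod_cast hn
  have hmeas : ∀ i, AEMeasurable (fun ω => -Real.cos (2 * Real.pi * η i ω)) μ := fun i =>
    (Real.measurable_cos.comp (measurable_const.mul measurable_id)).neg.comp_aemeasurable
      (hη i).aemeasurable
  have hmean : ∀ i, ∫ ω, -Real.cos (2 * Real.pi * η i ω) ∂μ = -r := by
    intro i
    have h := (hη i).integral_comp (f := fun x => Real.cos (2 * Real.pi * x)) (by fun_prop)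
    rw [integral_neg]
    simp only [Function.comp_def] at h
    rw [h, integral_cos_gaussianReal, hr, Real.coe_toNNReal _ (sq_nonneg σ)]
    congr 2; ring
  -- The parameter `1` is the squared half-length of `[-1, 1]`.
  have hsub : ∀ i ∈ Finset.univ, HasSubgaussianMGF
      (fun ω => -Real.cos (2 * Real.pi * η i ω) + r) 1 μ := by
    intro i _
    have h := hasSubgaussianMGF_of_mem_Icc (a := -1) (b := 1) (hmeas i)
      (Filter.Eventually.of_forall fun ω =>
        ⟨neg_le_neg (Real.cos_le_one _), by linarith [Real.neg_one_le_cos (2 * Real.pi * η i ω)]⟩)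
    simp only [hmean, sub_neg_eq_add] at h
    convert h using 1
    apply NNReal.eq
    norm_num
  have hind' : iIndepFun (fun i ω => -Real.cos (2 * Real.pi * η i ω) + r) μ :=
    hind.comp (fun _ x => -Real.cos (2 * Real.pi * x) + r) fun _ => by fun_prop
  have hH := HasSubgaussianMGF.measure_sum_ge_le_of_iIndepFun hind' hsub
    (ε := n * (ε * r)) (by positivity)
  have hexp : -(n * (ε * r)) ^ 2 / (2 * ((∑ _i : Fin n, (1 : NNReal) : NNReal) : ℝ))
      = -(Real.exp (-4 * Real.pi ^ 2 * σ ^ 2) * n * ε ^ 2 / 2) := by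
    have hq : Real.exp (-4 * Real.pi ^ 2 * σ ^ 2) = r ^ 2 := by
      rw [hr, ← Real.exp_nat_mul]; congr 1; push_cast; ring
    rw [hq]
    simp
    field_simp
  rw [hexp] at hH
  set S := {ω | n * (ε * r) ≤ ∑ i, (-Real.cos (2 * Real.pi * η i ω) + r)}
  have hS : NullMeasurableSet S μ :=
    nullMeasurableSet_le aemeasurable_const
      (Finset.aemeasurable_fun_sum _ fun i _ => (hmeas i).add_const r)
  have hcompl : Sᶜ ⊆ {ω | n * ((1 - ε) * r) ≤ ∑ i, Real.cos (2 * Real.pi * η i ω)} := by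
    intro ω hω
    simp only [S, Set.mem_compl_iff, Set.mem_ofPred_eq, not_le, Finset.sum_add_distrib,
      Finset.sum_neg_distrib, Finset.sum_const, Finset.card_univ, Fintype.card_fin,
      nsmul_eq_mul] at hω ⊢
    linarith
  have h1 := measureReal_mono (μ := μ) hcompl
  rw [probReal_compl_eq_one_sub₀ hS] at h1
  linarith

end Concentration


/-! ### The error bounds on the good event, and the theorem. -/

/-- The gain term in the sharper error bound is dominated by a small multiple of the main term. -/
theorem gain_le {l r ε s : ℝ} (hl : 0 ≤ l) (hr : 0 < r) (hr1 : r ≤ 1) (hε : 0 < ε)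
    (hs : 0 ≤ s) (hs1 : s ≤ 1 / 2) (hp : (1 - ε) * r = 1 - 2 * s ^ 2) :
    l / (6 * (4 * l + 1) ^ 2) * (1 - ε) * (1 - r ^ 2) ^ 2 ≤ s / 48 := by
  -- `l / (4l + 1)²` is largest at `l = 1/4`, with value `1/16`.
  have h1 : l / (6 * (4 * l + 1) ^ 2) ≤ 1 / 96 := by
    rw [div_le_div_iff₀ (by positivity) (by norm_num)]
    nlinarith [sq_nonneg (4 * l - 1)]
  -- Since `r ≥ (1 - ε) r = 1 - 2 s²`.
  have h2 : 1 - r ^ 2 ≤ 4 * s ^ 2 := by nlinarith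
  have h3 : 0 ≤ 1 - r ^ 2 := by nlinarith
  have h4 : (1 - r ^ 2) ^ 2 ≤ 2 * s := by
    have h5 : s ^ 3 ≤ (1 / 2) ^ 3 := pow_le_pow_left₀ hs hs1 3
    calc (1 - r ^ 2) ^ 2 ≤ (4 * s ^ 2) ^ 2 := pow_le_pow_left₀ h3 h2 2
      _ = 16 * s * s ^ 3 := by ring
      _ ≤ 16 * s * (1 / 2) ^ 3 := mul_le_mul_of_nonneg_left h5 (by positivity)
      _ = 2 * s := by ring
  have h6 : l / (6 * (4 * l + 1) ^ 2) * (1 - ε) ≤ 1 / 96 := by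
    refine le_trans (mul_le_of_le_one_right (by positivity) (by linarith)) h1
  calc _ ≤ 1 / 96 * (2 * s) := mul_le_mul h6 h4 (sq_nonneg _) (by norm_num)
    _ = s / 48 := by ring

/-- Deterministic core: both bounds for one noise vector `η` satisfying the Hoeffding event `hgood`.
-/
theorem trust_region_error_bounds {n k : ℕ} (hn : 2 ≤ n) {lam σ M α ε : ℝ} (hlam : 0 ≤ lam)
    (hlk : 4 * lam * k < 1) (hM : 0 < M) (hα : 0 < α) {f : ℝ → ℝ} (hf : IsHolderOnUnit f M α)
    (hε : 0 < ε) (hε1 : ε < 1 / 2)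
    (hp : 1 / 2 ≤ (1 - ε) * Real.exp (-2 * Real.pi ^ 2 * σ ^ 2)) {η : Fin n → ℝ}
    {g : Fin n ⊕ Fin n → ℝ}
    (hg : IsTrustRegionSolution n k lam (realVersion (noisySignal n f η)) g)
    (hgood : n * ((1 - ε) * Real.exp (-2 * Real.pi ^ 2 * σ ^ 2))
      ≤ ∑ i, Real.cos (2 * Real.pi * η i)) :
    1 - (3 * √((1 - (1 - ε) * Real.exp (-2 * Real.pi ^ 2 * σ ^ 2)) / 2)
          - lam * k / (6 * (4 * lam * k + 1) ^ 2) * (1 - ε)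
            * (1 - Real.exp (-4 * Real.pi ^ 2 * σ ^ 2)) ^ 2)
        - lam * Real.pi ^ 2 * M ^ 2 * (2 * (k : ℝ)) ^ (2 * α + 1) / (n : ℝ) ^ (2 * α)
          * (1 - Real.exp (-4 * Real.pi ^ 2 * σ ^ 2) / (4 * lam * k + 1) ^ 2)
      ≤ 1 / (n : ℝ) * (realVersion (cleanSignal n f) ⬝ᵥ g) ∧
    1 - 3 * √((1 - (1 - ε) * Real.exp (-2 * Real.pi ^ 2 * σ ^ 2)) / 2)
        - lam * Real.pi ^ 2 * M ^ 2 * (2 * (k : ℝ)) ^ (2 * α + 1) / (n : ℝ) ^ (2 * α)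
      ≤ 1 / (n : ℝ) * (realVersion (cleanSignal n f) ⬝ᵥ g) := by
  have hn0 : (0 : ℝ) < n := by exact_mod_cast (by omega : 0 < n)
  have hq : Real.exp (-4 * Real.pi ^ 2 * σ ^ 2) = Real.exp (-2 * Real.pi ^ 2 * σ ^ 2) ^ 2 := by
    rw [← Real.exp_nat_mul]; congr 1; push_cast; ring
  have hr0 : 0 < Real.exp (-2 * Real.pi ^ 2 * σ ^ 2) := Real.exp_pos _
  have hr1 : Real.exp (-2 * Real.pi ^ 2 * σ ^ 2) ≤ 1 :=
    Real.exp_le_one_iff.2 (by nlinarith [mul_nonneg (sq_nonneg Real.pi) (sq_nonneg σ)])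
  rw [hq]
  generalize Real.exp (-2 * Real.pi ^ 2 * σ ^ 2) = r at *
  set s := √((1 - (1 - ε) * r) / 2) with hs
  set B := lam * Real.pi ^ 2 * M ^ 2 * (2 * (k : ℝ)) ^ (2 * α + 1) / (n : ℝ) ^ (2 * α) with hB
  have hs2 : s ^ 2 = (1 - (1 - ε) * r) / 2 := Real.sq_sqrt (by nlinarith)
  have hs0 : 0 ≤ s := Real.sqrt_nonneg _
  have hs1 : s ≤ 1 / 2 := by nlinarith
  have hps : (1 - ε) * r = 1 - 2 * s ^ 2 := by linarith
  have ht : 0 ≤ 4 * lam * k := by positivity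
  have hzN : realVersion (noisySignal n f η) ⬝ᵥ realVersion (noisySignal n f η) = n :=
    dotProduct_realVersion_angular_self _
  obtain ⟨m, hm, x, hx, hsol, huniq⟩ := exists_stationary_unique hlam hlk hzN
  obtain rfl := huniq g hg
  have hmain := (posSemidef_blockLaplacian hlam).correlation_solution_ge ht hlk.le
    (dotProduct_blockLaplacian_le hlam) (h := realVersion (cleanSignal n f)) hm hx hn0
    (mem_feasibleSphere.1 hg.1) hzN (dotProduct_realVersion_angular_self _) hs0
    (by rw [cleanSignal_dotProduct_noisySignal, ← hps]; exact hgood)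
  have hbB := cleanSignal_blockLaplacian_le (k := k) hlam hn hM hα hf
  rw [← hB] at hbB
  have hB0 : 0 ≤ B := by positivity
  have hT0 : 0 < (4 * lam * k + 1) ^ 2 := by positivity
  have hT1 : 1 ≤ (4 * lam * k + 1) ^ 2 := by nlinarith
  have hw0 : 0 ≤ 1 - 1 / (4 * lam * k + 1) ^ 2 := sub_nonneg.2 ((div_le_one hT0).2 hT1)
  rw [add_comm 1 (4 * lam * (k : ℝ))] at hmain
  have hcore : 1 - 143 / 48 * s - B * (1 - 1 / (4 * lam * k + 1) ^ 2)
      ≤ 1 / (n : ℝ) * (realVersion (cleanSignal n f) ⬝ᵥ g) := by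
    rw [one_div_mul_eq_div, le_div_iff₀ hn0]
    have := mul_le_mul_of_nonneg_right hbB hw0
    linarith
  constructor
  · have hgain := gain_le (l := lam * k) (by positivity) hr0 hr1 hε hs0 hs1 hps
    rw [← mul_assoc] at hgain
    have h1 : B * (1 - 1 / (4 * lam * k + 1) ^ 2) ≤ B * (1 - r ^ 2 / (4 * lam * k + 1) ^ 2) := by
      gcongr
      exact pow_le_one₀ hr0.le hr1
    linarith
  · have h1 : B * (1 - 1 / (4 * lam * k + 1) ^ 2) ≤ B :=
      mul_le_of_le_one_right hB0 (sub_le_self _ (by positivity))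
    linarith

end ModOne

theorem theorem4 :
    ∃ c : ℝ, 0 < c ∧ ∃ c' : ℝ, 0 < c' ∧
      ∀ {Ω : Type*} [MeasurableSpace Ω] (μ : Measure Ω) [IsProbabilityMeasure μ]
        (n k : ℕ) (_ : 1 ≤ n) (_ : 1 ≤ k)
        (lam σ M α : ℝ) (_ : 0 ≤ lam) (_ : lam < 1 / (4 * (k : ℝ))) (_ : 0 ≤ σ)
        (_ : 0 < M) (_ : 0 < α) (_ : α ≤ 1)
        (f : ℝ → ℝ) (_ : ModOne.IsHolderOnUnit f M α)
        (η : Fin n → Ω → ℝ)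
        (_ : ∀ i, HasLaw (η i) (gaussianReal 0 (Real.toNNReal (σ ^ 2))) μ)
        (_ : iIndepFun η μ),
        (∀ ω, ∃! g : Fin n ⊕ Fin n → ℝ,
          ModOne.IsTrustRegionSolution n k lam
            (ModOne.realVersion (ModOne.noisySignal n f (fun i => η i ω))) g) ∧
        (2 ≤ n →
          ∀ (ghat : Ω → Fin n ⊕ Fin n → ℝ)
            (_ : ∀ ω, ModOne.IsTrustRegionSolution n k lam
              (ModOne.realVersion (ModOne.noisySignal n f (fun i => η i ω))) (ghat ω))
            (ε : ℝ) (_ : 0 < ε) (_ : ε < 1 / 2)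
            (_ : 1 / 2 ≤ (1 - ε) * Real.exp (-2 * Real.pi ^ 2 * σ ^ 2)),
            1 - 2 * Real.exp 1 *
                  Real.exp (-(c' * (1 - ε) ^ 2 * (1 - Real.exp (-4 * Real.pi ^ 2 * σ ^ 2)) ^ 4
                    * Real.exp (4 * Real.pi ^ 2 * σ ^ 2)) / 2304 * n)
                - 4 * Real.exp (-(c * ε ^ 2
                    * (1 - Real.exp (-4 * Real.pi ^ 2 * σ ^ 2)) ^ 4 * n / 1024))
                - Real.exp 1 *
                  Real.exp (-(c' * Real.exp (-4 * Real.pi ^ 2 * σ ^ 2) * n * ε ^ 2 / 4))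
              ≤ μ.real {ω |
                1 - (3 * √((1 - (1 - ε) * Real.exp (-2 * Real.pi ^ 2 * σ ^ 2)) / 2)
                    - lam * k / (6 * (4 * lam * k + 1) ^ 2) * (1 - ε)
                      * (1 - Real.exp (-4 * Real.pi ^ 2 * σ ^ 2)) ^ 2)
                  - lam * Real.pi ^ 2 * M ^ 2 * (2 * (k : ℝ)) ^ (2 * α + 1) / (n : ℝ) ^ (2 * α)
                    * (1 - Real.exp (-4 * Real.pi ^ 2 * σ ^ 2) / (4 * lam * k + 1) ^ 2)
                ≤ 1 / (n : ℝ) * (ModOne.realVersion (ModOne.cleanSignal n f) ⬝ᵥ ghat ω)} ∧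
            1 - Real.exp 1 *
                  Real.exp (-(c' * Real.exp (-4 * Real.pi ^ 2 * σ ^ 2) * n * ε ^ 2 / 4))
              ≤ μ.real {ω |
                1 - 3 * √((1 - (1 - ε) * Real.exp (-2 * Real.pi ^ 2 * σ ^ 2)) / 2)
                  - lam * Real.pi ^ 2 * M ^ 2 * (2 * (k : ℝ)) ^ (2 * α + 1) / (n : ℝ) ^ (2 * α)
                ≤ 1 / (n : ℝ) * (ModOne.realVersion (ModOne.cleanSignal n f) ⬝ᵥ ghat ω)}) := by
  -- Hoeffding's exponent `1/2` is better than the required `1/4`, so both constants can be `1`.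
  refine ⟨1, one_pos, 1, one_pos, ?_⟩
  intro Ω _ μ _ n k hn hk lam σ M α hlam hlam' _ hM hα _ f hf η hη hind
  have hk0 : (0 : ℝ) < k := by exact_mod_cast hk
  have hlk : 4 * lam * k < 1 := by
    rw [lt_div_iff₀ (by positivity)] at hlam'
    linarith
  refine ⟨fun ω => ?_, fun hn2 ghat hghat ε hε hε1 hp => ?_⟩
  · obtain ⟨_, _, x, _, hsol, huniq⟩ := ModOne.exists_stationary_unique (k := k) hlam hlk
      (z := ModOne.realVersion (ModOne.noisySignal n f (fun i => η i ω)))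
      (ModOne.dotProduct_realVersion_angular_self _)
    exact ⟨x, hsol, huniq⟩
  · have hprob := ModOne.measureReal_sum_cos_ge μ hn hη hind hε
    have hbound := fun ω => ModOne.trust_region_error_bounds hn2 hlam hlk hM hα hf hε hε1 hp
      (hghat ω)
    have hexp : Real.exp (-(Real.exp (-4 * Real.pi ^ 2 * σ ^ 2) * n * ε ^ 2 / 2))
        ≤ Real.exp 1
          * Real.exp (-(1 * Real.exp (-4 * Real.pi ^ 2 * σ ^ 2) * n * ε ^ 2 / 4)) := by
      rw [← Real.exp_add, Real.exp_le_exp]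
      have : 0 ≤ Real.exp (-4 * Real.pi ^ 2 * σ ^ 2) * n * ε ^ 2 := by positivity
      linarith
    have hle := (sub_le_sub_left hexp 1).trans hprob
    constructor
    -- Monotonicity of `μ.real` needs no measurability of `ghat`. The two further exponential terms
    -- only lower the claimed probability.
    · refine le_trans ?_ (hle.trans (measureReal_mono fun ω hω => (hbound ω hω).1))
      have h1 : 0 ≤ 2 * Real.exp 1 *
          Real.exp (-(1 * (1 - ε) ^ 2 * (1 - Real.exp (-4 * Real.pi ^ 2 * σ ^ 2)) ^ 4
            * Real.exp (4 * Real.pi ^ 2 * σ ^ 2)) / 2304 * n) := by positivity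
      have h2 : 0 ≤ 4 * Real.exp (-(1 * ε ^ 2
          * (1 - Real.exp (-4 * Real.pi ^ 2 * σ ^ 2)) ^ 4 * n / 1024)) := by positivity
      linarith
    · exact hle.trans (measureReal_mono fun ω hω => (hbound ω hω).2)
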